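/- Write $S^{d}(r)$ for the sphere of radius $r>0$ centred at the origin of $\mathbb R^{d+1}$, with the metric induced by $\mathbb R^{d+1}$, and $S^d=S^d(1)$. A \emph{harmonic form of degree $k$} is a map $F:\mathbb R^{m+1}\to\mathbb R^{n+1}$ whose components are homogeneous polynomials of degree $k$ (possibly zero) and which satisfies $\Delta F=0$ on $\mathbb R^{m+1}$. For a smooth map $\varphi$ between Riemannian manifolds let $e(\varphi)=\frac12|d\varphi|^2$ be its energy density, $\tau(\varphi)=\operatorname{trace}\nabla d\varphi$ its tension field and $$\tau_2(\varphi)=-\Delta\tau(\varphi)-\operatorname{trace}R^N(d\varphi(\cdot),\tau(\varphi))d\varphi(\cdot)$$ its bitension field, where $N$ is the target, $\Delta\sigma=-\operatorname{trace}\nabla^2\sigma$ on sections of $\varphi^{-1}TN$, and $R(X,Y)Z=\nabla_X\nabla_YZ-\nabla_Y\nabla_XZ-\nabla_{[X,Y]}Z$. The map $\varphi$ is \emph{proper biharmonic} if $\tau_2(\varphi)=0$ identically but $\tau(\varphi)$ does not vanish identically. \textbf{Theorem.} Let $m_1,m_2,n_1,n_2,k_1,k_2\ge 0$ be integers and let $r_1,r_2>0$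 with $r_1^2+r_2^2=1$. For $i=1,2$ let $F_i:\mathbb R^{m_i+1}\to\mathbb R^{n_i+1}$ be a harmonic form of degree $k_i$ that restricts to a map $\varphi_i:S^{m_i}\to S^{n_i}(r_i)$. Let $S^{m_1}\times S^{m_2}$ carry the product metric, let $\iota:S^{n_1}(r_1)\times S^{n_2}(r_2)\to S^{n_1+n_2+1}$ be the canonical inclusion, and let $$\varphi=\iota\circ(\varphi_1,\varphi_2):S^{m_1}\times S^{m_2}\to S^{n_1+n_2+1},\qquad \varphi(x,y)=(\varphi_1(x),\varphi_2(y)).$$ Then the energy densities $e(\varphi_1)$ and $e(\varphi_2)$ are constant, and $\varphi$ is proper biharmonic if and only if $r_1=r_2=1/\sqrt2$ and $e(\varphi_1)\neq e(\varphi_2)$. Moreover, $$\tau_2(\varphi)=(2r_1^2-1)\left(\frac{2e(\varphi_1)}{r_1^2}-\frac{2e(\varphi_2)}{r_2^2}\right)\tau(\varphi)$$ on $S^{m_1}\times S^{m_2}$. -/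

import Mathlib

open Metric Module
open scoped Manifold ContDiff RealInnerProductSpace

/-!
Riemannian geometry of submanifolds of Euclidean spaces.  A Riemannian manifold `M` is given as a
manifold (charted space, model `I`) with an immersion `ι : M → V` into a Euclidean space `V`,
and carries the metric induced by `ι`.  The tangent space at `x` is identified with the subspace
`dι_x(T_x M)` of `V`, so vector fields on `M` are functions `X : M → V` with `X x` in that subspace.
A section of the pull-back bundle `φ⁻¹TN` for a map `φ : M → N` is in the same way a function
`σ : M → W` with `σ x` tangent to `N` at `φ x`, where `j : N → W` is the immersion of `N`.
-/

noncomputable section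

namespace RiemannianSubmanifold

variable {E : Type*} [NormedAddCommGroup E] [NormedSpace ℝ E]
  {H : Type*} [TopologicalSpace H] (I : ModelWithCorners ℝ E H)
  {M : Type*} [TopologicalSpace M] [ChartedSpace H M]
  {V : Type*} [NormedAddCommGroup V] [InnerProductSpace ℝ V] [FiniteDimensional ℝ V]
  (ι : M → V)

/-- The tangent space of `M` at `x`, as the subspace `dι_x(T_x M)` of the ambient space. -/
def tangentSubspace (x : M) : Submodule ℝ V :=
  (mvfderiv I ι x).range

/-- Orthogonal projection of an ambient vector onto the tangent space of `M` at `x`. -/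
def tangentProj (x : M) (u : V) : V :=
  (tangentSubspace I ι x).starProjection u

/-- The derivative at `x` of a vector-valued function `f` on `M`, in the direction of a tangent
vector `u ∈ dι_x(T_x M)`: the differential of `f` applied to the vector that `dι_x` sends to `u`. -/
def dirDeriv {F : Type*} [NormedAddCommGroup F] [NormedSpace ℝ F]
    (f : M → F) (x : M) (u : V) : F :=
  mvfderiv I f x (Function.invFun (mvfderiv I ι x) u)

/-- The Levi-Civita connection `∇_u X` of the induced metric: the tangential part of the
derivative of the vector field `X` (Gauss formula). -/
def leviCivita (X : M → V) (x : M) (u : V) : V :=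
  tangentProj I ι x (dirDeriv I ι X x u)

/-- The Lie bracket `[X, Y] = D_X Y - D_Y X` of two vector fields. -/
def lieBracket (X Y : M → V) (x : M) : V :=
  dirDeriv I ι Y x (X x) - dirDeriv I ι X x (Y x)

/-- The vector field `y ↦ (tangential part of u at y)`.  It extends a vector `u` tangent at some
point `x` to a vector field on `M`; the tensors below do not depend on the extension. -/
def extend (u : V) : M → V := fun y => tangentProj I ι y u

/-- `R(X, Y)Z = ∇_X ∇_Y Z - ∇_Y ∇_X Z - ∇_{[X, Y]} Z` for vector fields. -/
def curvatureField (X Y Z : M → V) (x : M) : V :=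
  leviCivita I ι (fun y => leviCivita I ι Z y (Y y)) x (X x)
    - leviCivita I ι (fun y => leviCivita I ι Z y (X y)) x (Y x)
    - leviCivita I ι Z x (lieBracket I ι X Y x)

/-- The curvature tensor `R_x(u, v)w` at tangent vectors `u, v, w`. -/
def curvature (x : M) (u v w : V) : V :=
  curvatureField I ι (extend I ι u) (extend I ι v) (extend I ι w) x

/-- The trace over the tangent space at `x` of a bilinear form: `∑ B(e_i, e_i)` over an orthonormal
basis of the tangent space. -/
def traceAt {W : Type*} [AddCommGroup W] (x : M) (B : V → V → W) : W :=
  ∑ i, B (stdOrthonormalBasis ℝ (tangentSubspace I ι x) i)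
    (stdOrthonormalBasis ℝ (tangentSubspace I ι x) i)

section Maps

variable {E' : Type*} [NormedAddCommGroup E'] [NormedSpace ℝ E']
  {H' : Type*} [TopologicalSpace H'] (J : ModelWithCorners ℝ E' H')
  {N : Type*} [TopologicalSpace N] [ChartedSpace H' N]
  {W : Type*} [NormedAddCommGroup W] [InnerProductSpace ℝ W] [FiniteDimensional ℝ W]
  (j : N → W)

/-- The differential `dφ_x(u)`, as a vector of the ambient space of the target. -/
def differential {N W : Type*} [NormedAddCommGroup W] [NormedSpace ℝ W]
    (j : N → W) (φ : M → N) (x : M) (u : V) : W :=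
  dirDeriv I ι (fun y => j (φ y)) x u

/-- The energy density `e(φ) = |dφ|² / 2`. -/
def energyDensity {N W : Type*} [NormedAddCommGroup W] [InnerProductSpace ℝ W]
    (j : N → W) (φ : M → N) (x : M) : ℝ :=
  traceAt I ι x (fun u v => ⟪differential I ι j φ x u, differential I ι j φ x v⟫) / 2

/-- The pull-back connection `∇^φ_u σ` on sections `σ` of `φ⁻¹TN`. -/
def pullbackConnection (φ : M → N) (σ : M → W) (x : M) (u : V) : W :=
  tangentProj J j (φ x) (dirDeriv I ι σ x u)

/-- The second fundamental form `(∇dφ)(u, v) = ∇^φ_u (dφ(Y)) - dφ(∇_u Y)`, where `Y` is a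
vector field with `Y x = v`. -/
def secondFundamentalForm (φ : M → N) (x : M) (u v : V) : W :=
  pullbackConnection I ι J j φ (fun y => differential I ι j φ y (extend I ι v y)) x u
    - differential I ι j φ x (leviCivita I ι (extend I ι v) x u)

/-- The tension field `τ(φ) = trace ∇dφ`. -/
def tension (φ : M → N) (x : M) : W :=
  traceAt I ι x (secondFundamentalForm I ι J j φ x)

/-- The second covariant derivative `(∇²σ)(u, v) = ∇^φ_u (∇^φ_Y σ) - ∇^φ_{∇_u Y} σ`, where `Y` is a
vector field with `Y x = v`. -/
def secondCovariantDerivative (φ : M → N) (σ : M → W) (x : M) (u v : V) : W :=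
  pullbackConnection I ι J j φ
      (fun y => pullbackConnection I ι J j φ σ y (extend I ι v y)) x u
    - pullbackConnection I ι J j φ σ x (leviCivita I ι (extend I ι v) x u)

/-- The rough Laplacian `Δσ = - trace ∇²σ` on sections of `φ⁻¹TN`. -/
def roughLaplacian (φ : M → N) (σ : M → W) (x : M) : W :=
  - traceAt I ι x (secondCovariantDerivative I ι J j φ σ x)

/-- The bitension field `τ₂(φ) = - Δτ(φ) - trace R^N(dφ(·), τ(φ))dφ(·)`. -/
def bitension (φ : M → N) (x : M) : W :=
  - roughLaplacian I ι J j φ (tension I ι J j φ) x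
    - traceAt I ι x (fun u v => curvature J j (φ x) (differential I ι j φ x u)
        (tension I ι J j φ x) (differential I ι j φ x v))

/-- Harmonic maps: smooth maps with vanishing tension field. -/
def IsHarmonicMap (φ : M → N) : Prop :=
  ContMDiff I J ∞ φ ∧ ∀ x, tension I ι J j φ x = 0

/-- Biharmonic maps: smooth maps with vanishing bitension field. -/
def IsBiharmonicMap (φ : M → N) : Prop :=
  ContMDiff I J ∞ φ ∧ ∀ x, bitension I ι J j φ x = 0

/-- Proper biharmonic maps: biharmonic maps that are not harmonic. -/
def IsProperBiharmonicMap (φ : M → N) : Prop :=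
  IsBiharmonicMap I ι J j φ ∧ ¬ IsHarmonicMap I ι J j φ

end Maps

end RiemannianSubmanifold

/-- `ℝ^d` with its Euclidean inner product. -/
abbrev Euc (d : ℕ) : Type := EuclideanSpace ℝ (Fin d)

/-- The Euclidean space `ℝ^(a+1) ⊕ ℝ^(b+1) = ℝ^(a+b+2)`. -/
abbrev EucSum (a b : ℕ) : Type := WithLp 2 (Euc (a + 1) × Euc (b + 1))

/-- The sphere `S^d(r)` of radius `r` centred at the origin of `ℝ^(d+1)`. -/
abbrev Sph (d : ℕ) (r : ℝ) : Type := sphere (0 : Euc (d + 1)) r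

/-- The unit sphere `S^(a+b+1)` of `ℝ^(a+1) ⊕ ℝ^(b+1) = ℝ^(a+b+2)`. -/
abbrev SphSum (a b : ℕ) : Type := sphere (0 : EucSum a b) 1

instance eucSum_finrank (a b : ℕ) : Fact (finrank ℝ (EucSum a b) = (a + b + 1) + 1) :=
  ⟨by
    rw [LinearEquiv.finrank_eq (WithLp.linearEquiv 2 ℝ (Euc (a + 1) × Euc (b + 1)))]
    simp
    omega⟩

/-- A form of degree `k`: every component is a homogeneous polynomial of degree `k`
(the zero polynomial included). -/
def IsForm {m n : ℕ} (k : ℕ) (F : Euc (m + 1) → Euc (n + 1)) : Prop :=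
  ∀ i, ∃ p : MvPolynomial (Fin (m + 1)) ℝ, p.IsHomogeneous k ∧
    ∀ x, F x i = MvPolynomial.eval (fun l => x l) p

/-- A harmonic form of degree `k`. -/
def IsHarmonicForm {m n : ℕ} (k : ℕ) (F : Euc (m + 1) → Euc (n + 1)) : Prop :=
  IsForm k F ∧ ∀ x, Laplacian.laplacian F x = 0

/-- The standard isometric embedding of the Riemannian product `S^a × S^b` in
`ℝ^(a+1) ⊕ ℝ^(b+1)`. -/
def prodEmbedding (a b : ℕ) (p : Sph a 1 × Sph b 1) : EucSum a b :=
  WithLp.toLp 2 ((p.1 : Euc (a + 1)), (p.2 : Euc (b + 1)))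

/-- The canonical inclusion of `S^a(r₁) × S^b(r₂)` in `S^(a+b+1)`, for `r₁² + r₂² = 1`. -/
def prodInclusion {a b : ℕ} {r₁ r₂ : ℝ} (hr : r₁ ^ 2 + r₂ ^ 2 = 1)
    (q : Sph a r₁ × Sph b r₂) : SphSum a b :=
  ⟨WithLp.toLp 2 ((q.1 : Euc (a + 1)), (q.2 : Euc (b + 1))), by
    have h₁ : ‖(q.1 : Euc (a + 1))‖ = r₁ := mem_sphere_zero_iff_norm.1 q.1.2
    have h₂ : ‖(q.2 : Euc (b + 1))‖ = r₂ := mem_sphere_zero_iff_norm.1 q.2.2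
    rw [mem_sphere_zero_iff_norm, WithLp.prod_norm_eq_of_L2]
    simp [h₁, h₂, hr]⟩

/-- The product map `(x, y) ↦ (φ₁ x, φ₂ y)` from `S^m₁ × S^m₂` to `S^(n₁+n₂+1)`. -/
def productMap {m₁ m₂ n₁ n₂ : ℕ} {r₁ r₂ : ℝ} (hr : r₁ ^ 2 + r₂ ^ 2 = 1)
    (φ₁ : Sph m₁ 1 → Sph n₁ r₁) (φ₂ : Sph m₂ 1 → Sph n₂ r₂) :
    Sph m₁ 1 × Sph m₂ 1 → SphSum n₁ n₂ :=
  fun p => prodInclusion hr (φ₁ p.1, φ₂ p.2)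

/-- The energy density of a map from the unit sphere `S^m` to `S^n(r)`. -/
def sphereEnergyDensity {m n : ℕ} {r : ℝ} (φ : Sph m 1 → Sph n r) : Sph m 1 → ℝ :=
  RiemannianSubmanifold.energyDensity (𝓡 m) (Subtype.val : Sph m 1 → Euc (m + 1))
    (Subtype.val : Sph n r → Euc (n + 1)) φ

/-- The tension field of a map `S^m₁ × S^m₂ → S^(n₁+n₂+1)`. -/
def prodTension {m₁ m₂ n₁ n₂ : ℕ} (φ : Sph m₁ 1 × Sph m₂ 1 → SphSum n₁ n₂) :
    Sph m₁ 1 × Sph m₂ 1 → EucSum n₁ n₂ :=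
  RiemannianSubmanifold.tension ((𝓡 m₁).prod (𝓡 m₂)) (prodEmbedding m₁ m₂)
    (𝓡 (n₁ + n₂ + 1)) (Subtype.val : SphSum n₁ n₂ → EucSum n₁ n₂) φ

/-- The bitension field of a map `S^m₁ × S^m₂ → S^(n₁+n₂+1)`. -/
def prodBitension {m₁ m₂ n₁ n₂ : ℕ} (φ : Sph m₁ 1 × Sph m₂ 1 → SphSum n₁ n₂) :
    Sph m₁ 1 × Sph m₂ 1 → EucSum n₁ n₂ :=
  RiemannianSubmanifold.bitension ((𝓡 m₁).prod (𝓡 m₂)) (prodEmbedding m₁ m₂)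
    (𝓡 (n₁ + n₂ + 1)) (Subtype.val : SphSum n₁ n₂ → EucSum n₁ n₂) φ

/-- Proper biharmonicity of a map `S^m₁ × S^m₂ → S^(n₁+n₂+1)`. -/
def IsProperBiharmonicProd {m₁ m₂ n₁ n₂ : ℕ} (φ : Sph m₁ 1 × Sph m₂ 1 → SphSum n₁ n₂) : Prop :=
  RiemannianSubmanifold.IsProperBiharmonicMap ((𝓡 m₁).prod (𝓡 m₂)) (prodEmbedding m₁ m₂)
    (𝓡 (n₁ + n₂ + 1)) (Subtype.val : SphSum n₁ n₂ → EucSum n₁ n₂) φ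

end

/-! Write λᵢ = kᵢ(kᵢ + mᵢ − 1). Harmonicity and Euler's identity make the components of Fᵢ on the
unit sphere eigenfunctions of the Laplacian with eigenvalue λᵢ (`traceAt_sphereHessian`).
Differentiating |Fᵢ|² = rᵢ² twice turns this into |dφᵢ|² = λᵢ rᵢ², so e(φᵢ) is constant and
2e(φᵢ)/rᵢ² = λᵢ.

Hence τ(φ) is the tangential part of −(λ₁F₁, λ₂F₂) at (F₁, F₂). This is again of the form (aF₁, bF₂)
with a, b constant, and it vanishes exactly when λ₁ = λ₂ (`prodTension_eq`). Since dFᵢ is orthogonal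
to Fᵢ on tangent vectors, ∇τ(φ) is the plain derivative (a dF₁, b dF₂), so the trace computation
that gave τ(φ) also gives trace ∇²τ(φ) (`traceAt_pullbackConnection`). In the unit sphere, with dφ ⟂
τ(φ), the curvature trace is −|dφ|² τ(φ). The sum is τ₂(φ) = (2r₁² − 1)(λ₁ − λ₂) τ(φ)
(`prodBitension_eq`), and the criterion follows. -/

noncomputable section

namespace RiemannianSubmanifold

/-! ### Derivatives, projections and traces on immersed submanifolds. -/

section General

variable {E : Type*} [NormedAddCommGroup E] [NormedSpace ℝ E]
  {H : Type*} [TopologicalSpace H] {I : ModelWithCorners ℝ E H}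
  {M : Type*} [TopologicalSpace M] [ChartedSpace H M]
  {V : Type*} [NormedAddCommGroup V] [InnerProductSpace ℝ V] [FiniteDimensional ℝ V]
  {ι : M → V} {x : M}

/-- The directional derivative of the restriction to `M` of an ambient function. -/
theorem dirDeriv_eq_of_hasFDerivAt {F : Type*} [NormedAddCommGroup F] [NormedSpace ℝ F]
    {f : M → F} {g : V → F} {g' : V →L[ℝ] F} {u : V}
    (hι : MDifferentiableAt I 𝓘(ℝ, V) ι x) (hg : HasFDerivAt g g' (ι x))
    (hf : ∀ y, f y = g (ι y)) (hu : u ∈ tangentSubspace I ι x) :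
    dirDeriv I ι f x u = g' u := by
  obtain rfl : f = g ∘ ι := funext hf
  -- By the chain rule the value depends only on the image of `w`, so the preimage picked by
  -- `Function.invFun` is immaterial.
  have h : ∀ w, mvfderiv I (g ∘ ι) x w = g' (mvfderiv I ι x w) := fun w => by
    have := (hg.hasMFDerivAt.comp x hι.hasMFDerivAt).mfderiv
    simp only [mvfderiv, this]
    rfl
  have hex : ∃ w, mvfderiv I ι x w = u := hu
  rw [dirDeriv, h, Function.invFun_eq hex]

theorem dirDeriv_const {F : Type*} [NormedAddCommGroup F] [NormedSpace ℝ F] (c : F) (u : V) :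
    dirDeriv I ι (fun _ => c) x u = 0 := by
  simp [dirDeriv, mvfderiv, mfderiv_const]

variable (I ι x) in
theorem tangentProj_mem (u : V) : tangentProj I ι x u ∈ tangentSubspace I ι x :=
  (tangentSubspace I ι x).starProjection_apply_mem u

variable (I ι x) in
theorem extend_mem (u : V) : extend I ι u x ∈ tangentSubspace I ι x := tangentProj_mem I ι x u

theorem tangentProj_of_mem {u : V} (hu : u ∈ tangentSubspace I ι x) : tangentProj I ι x u = u :=
  Submodule.starProjection_eq_self_iff.2 hu

/-- Only diagonal values on tangent vectors enter the trace; this replaces geometric expressions,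
not bilinear on the whole ambient space, by honest bilinear forms. -/
theorem traceAt_congr {W : Type*} [AddCommGroup W] {B B' : V → V → W}
    (h : ∀ u ∈ tangentSubspace I ι x, B u u = B' u u) :
    traceAt I ι x B = traceAt I ι x B' :=
  Finset.sum_congr rfl fun i _ => h _ (stdOrthonormalBasis ℝ (tangentSubspace I ι x) i).2

theorem traceAt_map {W W' : Type*} [AddCommGroup W] [Module ℝ W] [AddCommGroup W'] [Module ℝ W']
    (L : W →ₗ[ℝ] W') (B : V → V → W) :
    traceAt I ι x (fun u v => L (B u v)) = L (traceAt I ι x B) := by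
  simp [traceAt, map_sum]

variable (I ι x) in
/-- The trace over the tangent space, computed by projecting an orthonormal basis of the ambient
space. -/
theorem traceAt_eq_sum_tangentProj {W : Type*} [AddCommGroup W] [Module ℝ W]
    {κ : Type*} [Fintype κ] (b : OrthonormalBasis κ ℝ V) (B : V →ₗ[ℝ] V →ₗ[ℝ] W) :
    traceAt I ι x (fun u v => B u v) =
      ∑ i, B (tangentProj I ι x (b i)) (tangentProj I ι x (b i)) := by
  set T := tangentSubspace I ι x
  set e := stdOrthonormalBasis ℝ T
  have hP : ∀ v, tangentProj I ι x v = ∑ k, ⟪(e k : V), v⟫ • (e k : V) := fun v => by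
    rw [tangentProj, e.starProjection_eq_sum_rankOne]
    simp
  -- Parseval for `b`, applied to the orthonormal vectors `e k`.
  have hδ : ∀ k l, ∑ i, ⟪(e k : V), b i⟫ * ⟪(e l : V), b i⟫ = if k = l then 1 else 0 := by
    intro k l
    have h1 := b.sum_inner_mul_inner (e k : V) (e l : V)
    have h2 := orthonormal_iff_ite.1 e.orthonormal k l
    rw [← h2, Submodule.coe_inner, ← h1]
    exact Finset.sum_congr rfl fun i _ => by rw [real_inner_comm (b i) (e l : V)]
  have : ∀ i, B (tangentProj I ι x (b i)) (tangentProj I ι x (b i)) =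
      ∑ k, ∑ l, (⟪(e k : V), b i⟫ * ⟪(e l : V), b i⟫) • B (e k : V) (e l : V) := fun i => by
    rw [hP]
    simp only [map_sum, LinearMap.sum_apply, map_smul, LinearMap.smul_apply]
    rw [Finset.sum_comm]
    simp only [Finset.smul_sum, smul_smul, mul_comm]
  simp_rw [this]
  rw [Finset.sum_comm]
  simp_rw [Finset.sum_comm (s := Finset.univ (α := κ)), ← Finset.sum_smul, hδ]
  simp [traceAt, e, T]

end General

/-! ### Connection and curvature of the unit sphere. -/

section Sphere

variable {E : Type*} [NormedAddCommGroup E] [InnerProductSpace ℝ E] [FiniteDimensional ℝ E]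
  {n : ℕ} [Fact (finrank ℝ E = n + 1)]

theorem mdifferentiableAt_coe_sphere (x : sphere (0 : E) 1) :
    MDifferentiableAt (𝓡 n) 𝓘(ℝ, E) ((↑) : sphere (0 : E) 1 → E) x :=
  (contMDiff_coe_sphere (m := 1) x).mdifferentiableAt one_ne_zero

theorem inner_self_coe_sphere (x : sphere (0 : E) 1) : ⟪(x : E), (x : E)⟫ = 1 := by
  rw [real_inner_self_eq_norm_sq, mem_sphere_zero_iff_norm.1 x.2, one_pow]

theorem mem_tangentSubspace_sphere {x : sphere (0 : E) 1} {u : E} :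
    u ∈ tangentSubspace (𝓡 n) ((↑) : sphere (0 : E) 1 → E) x ↔ ⟪(x : E), u⟫ = 0 := by
  rw [tangentSubspace, range_mvfderiv_subtypeVal, Submodule.mem_orthogonal_singleton_iff_inner_right]

theorem tangentProj_sphere (x : sphere (0 : E) 1) (u : E) :
    tangentProj (𝓡 n) ((↑) : sphere (0 : E) 1 → E) x u = u - ⟪(x : E), u⟫ • (x : E) := by
  refine Submodule.eq_starProjection_of_mem_of_inner_eq_zero ?_ fun w hw => ?_
  · rw [mem_tangentSubspace_sphere, inner_sub_right, inner_smul_right, inner_self_coe_sphere]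
    ring
  · rw [mem_tangentSubspace_sphere] at hw
    rw [sub_sub_cancel, inner_smul_left, hw, mul_zero]

theorem extend_sphere (u : E) (x : sphere (0 : E) 1) :
    extend (𝓡 n) ((↑) : sphere (0 : E) 1 → E) u x = u - ⟪(x : E), u⟫ • (x : E) :=
  tangentProj_sphere x u

/-- The unit normal at `x` is `x` itself, so the tangential trace is the ambient trace minus the
normal term. -/
theorem traceAt_sphere {W : Type*} [AddCommGroup W] [Module ℝ W] {κ : Type*} [Fintype κ]
    (b : OrthonormalBasis κ ℝ E) (x : sphere (0 : E) 1) (B : E →ₗ[ℝ] E →ₗ[ℝ] W) :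
    traceAt (𝓡 n) ((↑) : sphere (0 : E) 1 → E) x (fun u v => B u v) =
      ∑ i, B (b i) (b i) - B x x := by
  have hx : ∑ i, ⟪(x : E), b i⟫ • b i = (x : E) := by
    simpa only [real_inner_comm] using b.sum_repr' (x : E)
  have h1 : ∑ i, ⟪(x : E), b i⟫ • B x (b i) = B x x := by
    simp only [← map_smul, ← map_sum, hx]
  have h2 : ∑ i, ⟪(x : E), b i⟫ • B (b i) x = B x x := by
    simpa using congrArg (fun v => B v x) hx
  have h3 : ∑ i, ⟪(x : E), b i⟫ * ⟪(x : E), b i⟫ = 1 := by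
    refine Eq.trans ?_ ((b.sum_inner_mul_inner (x : E) (x : E)).trans (inner_self_coe_sphere x))
    exact Finset.sum_congr rfl fun i _ => by rw [real_inner_comm (x : E) (b i)]
  rw [traceAt_eq_sum_tangentProj _ _ _ b]
  have : ∀ i, B (tangentProj (𝓡 n) ((↑) : sphere (0 : E) 1 → E) x (b i))
      (tangentProj (𝓡 n) ((↑) : sphere (0 : E) 1 → E) x (b i)) =
      B (b i) (b i) - ⟪(x : E), b i⟫ • B x (b i) - ⟪(x : E), b i⟫ • B (b i) x
        + (⟪(x : E), b i⟫ * ⟪(x : E), b i⟫) • B x x := fun i => by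
    rw [tangentProj_sphere]
    simp only [map_sub, map_smul, LinearMap.sub_apply, LinearMap.smul_apply]
    module
  simp_rw [this]
  rw [Finset.sum_add_distrib, Finset.sum_sub_distrib, Finset.sum_sub_distrib, h1, h2,
    ← Finset.sum_smul, h3]
  module

theorem hasFDerivAt_inner_const (w z : E) :
    HasFDerivAt (fun y : E => ⟪y, w⟫) (innerSL ℝ w) z := by
  simp_rw [real_inner_comm w]
  exact (innerSL ℝ w).hasFDerivAt

theorem hasFDerivAt_sub_inner_smul (w z : E) :
    HasFDerivAt (fun y : E => w - ⟪y, w⟫ • y)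
      (-((innerSL ℝ w).smulRight z + ⟪z, w⟫ • ContinuousLinearMap.id ℝ E)) z := by
  refine (((hasFDerivAt_inner_const w z).smul (hasFDerivAt_id z)).const_sub w).congr_fderiv ?_
  ext u
  simp [add_comm]

theorem dirDeriv_extend_sphere (x : sphere (0 : E) 1) (w : E) {u : E}
    (hu : u ∈ tangentSubspace (𝓡 n) ((↑) : sphere (0 : E) 1 → E) x) :
    dirDeriv (𝓡 n) ((↑) : sphere (0 : E) 1 → E)
      (extend (𝓡 n) ((↑) : sphere (0 : E) 1 → E) w) x u =
      -(⟪w, u⟫ • (x : E) + ⟪(x : E), w⟫ • u) := by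
  rw [dirDeriv_eq_of_hasFDerivAt (mdifferentiableAt_coe_sphere x)
    (hasFDerivAt_sub_inner_smul w (x : E)) (extend_sphere w) hu]
  simp

/-- `w` need not be tangent at `x`: the curvature requires this field at nearby points too, where
the coefficient is nonzero. -/
theorem leviCivita_extend_sphere (x : sphere (0 : E) 1) (w : E) {u : E}
    (hu : u ∈ tangentSubspace (𝓡 n) ((↑) : sphere (0 : E) 1 → E) x) :
    leviCivita (𝓡 n) ((↑) : sphere (0 : E) 1 → E)
      (extend (𝓡 n) ((↑) : sphere (0 : E) 1 → E) w) x u = -(⟪(x : E), w⟫ • u) := by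
  rw [leviCivita, dirDeriv_extend_sphere x w hu, tangentProj_sphere]
  rw [mem_tangentSubspace_sphere] at hu
  simp only [inner_neg_right, inner_add_right, inner_smul_right, hu, inner_self_coe_sphere]
  module

theorem leviCivita_leviCivita_extend_sphere (x : sphere (0 : E) 1) {u v w : E}
    (hu : ⟪(x : E), u⟫ = 0) (hv : ⟪(x : E), v⟫ = 0) (hw : ⟪(x : E), w⟫ = 0) :
    leviCivita (𝓡 n) ((↑) : sphere (0 : E) 1 → E)
      (fun y => leviCivita (𝓡 n) ((↑) : sphere (0 : E) 1 → E)
        (extend (𝓡 n) ((↑) : sphere (0 : E) 1 → E) w) y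
        (extend (𝓡 n) ((↑) : sphere (0 : E) 1 → E) v y)) x
      (extend (𝓡 n) ((↑) : sphere (0 : E) 1 → E) u x) = -(⟪w, u⟫ • v) := by
  -- Product rule: at `x` the scalar factor ⟪y, w⟫ vanishes, so only its derivative contributes.
  have h := ((hasFDerivAt_inner_const w (x : E)).smul (hasFDerivAt_sub_inner_smul v (x : E))).neg
  have hfield : ∀ y : sphere (0 : E) 1, leviCivita (𝓡 n) ((↑) : sphere (0 : E) 1 → E)
      (extend (𝓡 n) ((↑) : sphere (0 : E) 1 → E) w) y
      (extend (𝓡 n) ((↑) : sphere (0 : E) 1 → E) v y) =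
      -(⟪(y : E), w⟫ • (v - ⟪(y : E), v⟫ • (y : E))) := fun y => by
    rw [leviCivita_extend_sphere y w (extend_mem _ _ y v), extend_sphere]
  rw [extend, tangentProj_of_mem (mem_tangentSubspace_sphere.2 hu), leviCivita,
    dirDeriv_eq_of_hasFDerivAt (mdifferentiableAt_coe_sphere x) h hfield
      (mem_tangentSubspace_sphere.2 hu), tangentProj_sphere]
  simp [hw, hv, inner_smul_right]

/-- The unit sphere has constant sectional curvature `1`. -/
theorem curvature_sphere (x : sphere (0 : E) 1) {u v w : E}
    (hu : ⟪(x : E), u⟫ = 0) (hv : ⟪(x : E), v⟫ = 0) (hw : ⟪(x : E), w⟫ = 0) :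
    curvature (𝓡 n) ((↑) : sphere (0 : E) 1 → E) x u v w = ⟪v, w⟫ • u - ⟪u, w⟫ • v := by
  have hu' := (mem_tangentSubspace_sphere (n := n)).2 hu
  have hv' := (mem_tangentSubspace_sphere (n := n)).2 hv
  -- At `x` both derivatives equal −⟪u, v⟫ x, so they cancel.
  have hb : lieBracket (𝓡 n) ((↑) : sphere (0 : E) 1 → E)
      (extend (𝓡 n) ((↑) : sphere (0 : E) 1 → E) u)
      (extend (𝓡 n) ((↑) : sphere (0 : E) 1 → E) v) x = 0 := by
    have hu₀ : extend (𝓡 n) ((↑) : sphere (0 : E) 1 → E) u x = u := tangentProj_of_mem hu'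
    have hv₀ : extend (𝓡 n) ((↑) : sphere (0 : E) 1 → E) v x = v := tangentProj_of_mem hv'
    rw [lieBracket, hu₀, hv₀, dirDeriv_extend_sphere x v hu', dirDeriv_extend_sphere x u hv']
    simp [hu, hv, real_inner_comm]
  rw [curvature, curvatureField, leviCivita_leviCivita_extend_sphere x hu hv hw,
    leviCivita_leviCivita_extend_sphere x hv hu hw, hb,
    leviCivita_extend_sphere x w (zero_mem _), real_inner_comm u w, real_inner_comm v w]
  simp only [smul_zero, neg_zero]
  module

end Sphere

end RiemannianSubmanifold

/-! ### Homogeneous harmonic maps and their restrictions to the unit sphere. -/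

/-- Smooth harmonic maps between vector spaces that are homogeneous of degree `k`, in the form of
Euler's identity. -/
structure IsHomogeneousHarmonic {E E' : Type*} [NormedAddCommGroup E] [InnerProductSpace ℝ E]
    [FiniteDimensional ℝ E] [NormedAddCommGroup E'] [InnerProductSpace ℝ E'] (k : ℕ)
    (F : E → E') : Prop where
  contDiff : ContDiff ℝ ∞ F
  fderiv_self : ∀ x, fderiv ℝ F x x = (k : ℝ) • F x
  laplacian_eq_zero : ∀ x, Laplacian.laplacian F x = 0

theorem MvPolynomial.IsHomogeneous.eval_smul {σ R : Type*} [CommSemiring R]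
    {p : MvPolynomial σ R} {k : ℕ} (hp : p.IsHomogeneous k) (t : R) (x : σ → R) :
    MvPolynomial.eval (fun i => t * x i) p = t ^ k * MvPolynomial.eval x p := by
  rw [MvPolynomial.eval_eq, MvPolynomial.eval_eq, Finset.mul_sum]
  refine Finset.sum_congr rfl fun d hd => ?_
  have hk : ∑ i ∈ d.support, d i = k := by
    have := hp (MvPolynomial.mem_support_iff.1 hd)
    rwa [Finsupp.weight_apply, Finsupp.sum, Finset.sum_congr rfl fun i _ => by
      rw [Pi.one_apply, smul_eq_mul, mul_one]] at this
  simp_rw [mul_pow, Finset.prod_mul_distrib, Finset.prod_pow_eq_pow_sum, hk]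
  ring

theorem MvPolynomial.contDiff_eval {d : ℕ} (p : MvPolynomial (Fin d) ℝ) :
    ContDiff ℝ ∞ fun x : Euc d => MvPolynomial.eval (fun l => x l) p := by
  induction p using MvPolynomial.induction_on with
  | C a => simpa using contDiff_const
  | add p q hp hq => simpa using hp.add hq
  | mul_X p i hp =>
    simp only [map_mul, MvPolynomial.eval_X]
    exact hp.mul (by fun_prop)

namespace IsHarmonicForm

variable {m n k : ℕ} {F : Euc (m + 1) → Euc (n + 1)}

theorem isHomogeneousHarmonic (hF : IsHarmonicForm k F) : IsHomogeneousHarmonic k F := by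
  have hsm : ContDiff ℝ ∞ F := by
    rw [contDiff_euclidean]
    intro i
    obtain ⟨p, -, hp⟩ := hF.1 i
    simp_rw [hp]
    exact p.contDiff_eval
  refine ⟨hsm, fun x => ?_, hF.2⟩
  have hom : ∀ t : ℝ, F (t • x) = t ^ k • F x := fun t => by
    ext i
    obtain ⟨p, hk, hp⟩ := hF.1 i
    simp only [hp, PiLp.smul_apply, smul_eq_mul]
    exact hk.eval_smul t _
  -- Euler's identity: F(tx) = tᵏ F(x) is differentiated at t = 1 in two ways.
  have h1 : HasDerivAt (fun t : ℝ => F (t • x)) (fderiv ℝ F x x) 1 := by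
    have hd : HasFDerivAt F (fderiv ℝ F x) ((1 : ℝ) • x) := by
      rw [one_smul]
      exact (hsm.differentiable (by simp) x).hasFDerivAt
    refine (hd.comp_hasDerivAt (1 : ℝ) ((hasDerivAt_id (1 : ℝ)).smul_const x)).congr_deriv ?_
    rw [one_smul]
  have h2 : HasDerivAt (fun t : ℝ => F (t • x)) ((k : ℝ) • F x) 1 := by
    simp_rw [hom]
    simpa using (hasDerivAt_pow k (1 : ℝ)).smul_const (F x)
  exact h1.unique h2

end IsHarmonicForm

namespace IsHomogeneousHarmonic

open RiemannianSubmanifold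

variable {E E' : Type*} [NormedAddCommGroup E] [InnerProductSpace ℝ E]
    [FiniteDimensional ℝ E] [NormedAddCommGroup E'] [InnerProductSpace ℝ E'] {k : ℕ}
    {F : E → E'}

theorem hasFDerivAt (hF : IsHomogeneousHarmonic k F) (x : E) : HasFDerivAt F (fderiv ℝ F x) x :=
  (hF.contDiff.differentiable (by simp) x).hasFDerivAt

theorem hasFDerivAt_fderiv (hF : IsHomogeneousHarmonic k F) (x : E) :
    HasFDerivAt (fderiv ℝ F) (fderiv ℝ (fderiv ℝ F) x) x :=
  ((hF.contDiff.fderiv_right (m := 1) (by norm_cast)).differentiable (by simp) x).hasFDerivAt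

/-- Differentiating Euler's identity in the direction `x` gives D²F(x, x) + DF(x) = k DF(x). -/
theorem fderiv_fderiv_self_self (hF : IsHomogeneousHarmonic k F) (x : E) :
    fderiv ℝ (fderiv ℝ F) x x x = ((k : ℝ) * (k - 1)) • F x := by
  have h1 := (hF.hasFDerivAt_fderiv x).clm_apply (hasFDerivAt_id x)
  have h2 : HasFDerivAt (fun y => fderiv ℝ F y y) ((k : ℝ) • fderiv ℝ F x) x := by
    simp_rw [hF.fderiv_self]
    exact (hF.hasFDerivAt x).const_smul (k : ℝ)
  have h3 := congrArg (fun L => L x) (h1.unique h2)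
  simp [hF.fderiv_self] at h3
  rw [eq_sub_of_add_eq' h3]
  module

theorem sum_fderiv_fderiv (hF : IsHomogeneousHarmonic k F) {κ : Type*} [Fintype κ]
    (b : OrthonormalBasis κ ℝ E) (x : E) : ∑ i, fderiv ℝ (fderiv ℝ F) x (b i) (b i) = 0 := by
  have := hF.laplacian_eq_zero x
  rw [InnerProductSpace.laplacian_eq_iteratedFDeriv_orthonormalBasis F b] at this
  simpa [iteratedFDeriv_two_apply] using this

variable (F) in
/-- The second derivative of `F` along the unit sphere: the derivative in the direction `u` of
`z ↦ DF_z(v - ⟪z, v⟫ z)`, for `u`, `v` tangent to the sphere. -/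
def sphereHessian (x : E) : E →ₗ[ℝ] E →ₗ[ℝ] E' :=
  LinearMap.mk₂ ℝ (fun u v => fderiv ℝ (fderiv ℝ F) x u v - ⟪u, v⟫ • fderiv ℝ F x x)
    (fun u u' v => by simp [inner_add_left]; module)
    (fun c u v => by simp [inner_smul_left, smul_sub, smul_smul])
    (fun u v v' => by simp [inner_add_right]; module)
    (fun c u v => by simp [inner_smul_right, smul_sub, smul_smul])

theorem sphereHessian_apply (x u v : E) :
    sphereHessian F x u v = fderiv ℝ (fderiv ℝ F) x u v - ⟪u, v⟫ • fderiv ℝ F x x := rfl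

/-- The argument v − ⟪z, v⟫ z is the ambient formula for the tangent extension of `v`, so this
differentiates DF along that field. -/
theorem hasFDerivAt_fderiv_sub_inner_smul (hF : IsHomogeneousHarmonic k F) (v x : E) :
    ∃ G' : E →L[ℝ] E', HasFDerivAt (fun z => fderiv ℝ F z (v - ⟪z, v⟫ • z)) G' x ∧
      (⟪x, v⟫ = 0 → ∀ u, G' u = sphereHessian F x u v) := by
  refine ⟨_, (hF.hasFDerivAt_fderiv x).clm_apply (hasFDerivAt_sub_inner_smul v x), fun hv u => ?_⟩
  simp [sphereHessian_apply, hv, real_inner_comm, sub_eq_add_neg, add_comm]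

section Sphere

/-- The ambient trace is 0 − (m + 1)kF by harmonicity, and the normal term to subtract is k(k − 1)F
− kF by the two Euler identities. -/
theorem traceAt_sphereHessian {m : ℕ} [Fact (finrank ℝ E = m + 1)]
    (hF : IsHomogeneousHarmonic k F) (x : sphere (0 : E) 1) :
    traceAt (𝓡 m) ((↑) : sphere (0 : E) 1 → E) x (fun u v => sphereHessian F x u v) =
      -(((k : ℝ) * (k + m - 1)) • F x) := by
  rw [traceAt_sphere (stdOrthonormalBasis ℝ E)]
  simp only [sphereHessian_apply, Finset.sum_sub_distrib, hF.sum_fderiv_fderiv, hF.fderiv_self,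
    hF.fderiv_fderiv_self_self, real_inner_self_eq_norm_sq,
    OrthonormalBasis.norm_eq_one, Finset.sum_const, Finset.card_univ, Fintype.card_fin,
    (Fact.out : finrank ℝ E = m + 1), mem_sphere_zero_iff_norm.1 x.2]
  simp only [one_pow]
  module

theorem inner_fderiv_eq_zero (m : ℕ) [Fact (finrank ℝ E = m + 1)] {r : ℝ}
    (hF : IsHomogeneousHarmonic k F)
    (hr : ∀ x : sphere (0 : E) 1, ‖F x‖ = r) (x : sphere (0 : E) 1) {u : E}
    (hu : ⟪(x : E), u⟫ = 0) : ⟪F x, fderiv ℝ F x u⟫ = 0 := by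
  have h := dirDeriv_eq_of_hasFDerivAt (f := fun _ => r ^ 2) (mdifferentiableAt_coe_sphere (n := m) x)
    ((hF.hasFDerivAt x).inner ℝ (hF.hasFDerivAt x))
    (fun y => by rw [real_inner_self_eq_norm_sq, hr]) (mem_tangentSubspace_sphere.2 hu)
  rw [dirDeriv_const] at h
  simp [real_inner_comm (F x)] at h
  linarith

theorem inner_sphereHessian (m : ℕ) [Fact (finrank ℝ E = m + 1)] {r : ℝ}
    (hF : IsHomogeneousHarmonic k F)
    (hr : ∀ x : sphere (0 : E) 1, ‖F x‖ = r) (x : sphere (0 : E) 1) {u v : E}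
    (hu : ⟪(x : E), u⟫ = 0) (hv : ⟪(x : E), v⟫ = 0) :
    ⟪fderiv ℝ F x u, fderiv ℝ F x v⟫ = -⟪F x, sphereHessian F x u v⟫ := by
  obtain ⟨G', hG, hG'⟩ := hF.hasFDerivAt_fderiv_sub_inner_smul v x
  -- The relation ⟪F, dF(v)⟫ = 0, with `v` extended to a tangent field, holds on the whole sphere
  -- and may be differentiated along `u`.
  have h := dirDeriv_eq_of_hasFDerivAt (f := fun _ => (0 : ℝ))
    (mdifferentiableAt_coe_sphere (n := m) x) ((hF.hasFDerivAt x).inner ℝ hG)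
    (fun y => (inner_fderiv_eq_zero m hF hr y (by
      rw [inner_sub_right, inner_smul_right, inner_self_coe_sphere]; ring)).symm)
    (mem_tangentSubspace_sphere.2 hu)
  rw [dirDeriv_const] at h
  simp [hv, hG' hv] at h
  linarith

theorem traceAt_inner_fderiv {m : ℕ} [Fact (finrank ℝ E = m + 1)] {r : ℝ}
    (hF : IsHomogeneousHarmonic k F)
    (hr : ∀ x : sphere (0 : E) 1, ‖F x‖ = r) (x : sphere (0 : E) 1) :
    traceAt (𝓡 m) ((↑) : sphere (0 : E) 1 → E) x
      (fun u v => ⟪fderiv ℝ F x u, fderiv ℝ F x v⟫) = k * (k + m - 1) * r ^ 2 := by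
  rw [traceAt_congr (B' := fun u v => -(innerₗ E' (F x)) (sphereHessian F x u v)) fun u hu => ?_]
  · have := traceAt_map (I := 𝓡 m) (ι := ((↑) : sphere (0 : E) 1 → E)) (x := x)
      (-(innerₗ E' (F x))) (fun u v => sphereHessian F x u v)
    refine this.trans ?_
    rw [hF.traceAt_sphereHessian]
    simp [inner_smul_right, hr]
  · rw [mem_tangentSubspace_sphere] at hu
    exact inner_sphereHessian m hF hr x hu hu

end Sphere

end IsHomogeneousHarmonic

open RiemannianSubmanifold

theorem fact_finrank_euc (d : ℕ) : Fact (finrank ℝ (Euc (d + 1)) = d + 1) :=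
  ⟨finrank_euclideanSpace_fin⟩

section Euclidean

attribute [local instance] fact_finrank_euc

theorem sphereEnergyDensity_eq {m n k : ℕ} {r : ℝ} {F : Euc (m + 1) → Euc (n + 1)}
    (hF : IsHomogeneousHarmonic k F) {φ : Sph m 1 → Sph n r}
    (hφ : ∀ x : Sph m 1, (φ x : Euc (n + 1)) = F x) (x : Sph m 1) :
    sphereEnergyDensity φ x = k * (k + m - 1) * r ^ 2 / 2 := by
  have hr : ∀ x : Sph m 1, ‖F x‖ = r := fun x => by
    rw [← hφ, mem_sphere_zero_iff_norm.1 (φ x).2]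
  rw [sphereEnergyDensity, energyDensity, ← hF.traceAt_inner_fderiv (m := m) hr x]
  congr 1
  refine traceAt_congr fun u hu => ?_
  rw [differential, dirDeriv_eq_of_hasFDerivAt (mdifferentiableAt_coe_sphere x)
    (hF.hasFDerivAt (x : Euc (m + 1))) hφ hu]

end Euclidean

/-! ### The product of two unit spheres as a submanifold. -/

section ProductOfSpheres

attribute [local instance] fact_finrank_euc

variable {m₁ m₂ : ℕ}

theorem contMDiff_prodEmbedding : ContMDiff ((𝓡 m₁).prod (𝓡 m₂)) 𝓘(ℝ, EucSum m₁ m₂) ∞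
    (prodEmbedding m₁ m₂) := by
  have h1 : ContMDiff ((𝓡 m₁).prod (𝓡 m₂)) 𝓘(ℝ, Euc (m₁ + 1) × Euc (m₂ + 1)) ∞
      (fun p : Sph m₁ 1 × Sph m₂ 1 => ((p.1 : Euc (m₁ + 1)), (p.2 : Euc (m₂ + 1)))) :=
    (contMDiff_coe_sphere.comp contMDiff_fst).prodMk_space
      (contMDiff_coe_sphere.comp contMDiff_snd)
  exact (WithLp.prodContinuousLinearEquiv 2 ℝ (Euc (m₁ + 1))
    (Euc (m₂ + 1))).symm.contDiff.contMDiff.comp h1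

theorem mdifferentiableAt_prodEmbedding (p : Sph m₁ 1 × Sph m₂ 1) :
    MDifferentiableAt ((𝓡 m₁).prod (𝓡 m₂)) 𝓘(ℝ, EucSum m₁ m₂) (prodEmbedding m₁ m₂) p :=
  (contMDiff_prodEmbedding p).mdifferentiableAt (by simp)

theorem mvfderiv_prodEmbedding (p : Sph m₁ 1 × Sph m₂ 1)
    (w : TangentSpace ((𝓡 m₁).prod (𝓡 m₂)) p) :
    mvfderiv ((𝓡 m₁).prod (𝓡 m₂)) (prodEmbedding m₁ m₂) p w =
      WithLp.toLp 2 (mvfderiv (𝓡 m₁) ((↑) : Sph m₁ 1 → Euc (m₁ + 1)) p.1 w.1,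
        mvfderiv (𝓡 m₂) ((↑) : Sph m₂ 1 → Euc (m₂ + 1)) p.2 w.2) := by
  have h1 := (mdifferentiableAt_coe_sphere (n := m₁) p.1).hasMFDerivAt.comp p
    (hasMFDerivAt_fst (I := 𝓡 m₁) (I' := 𝓡 m₂) p)
  have h2 := (mdifferentiableAt_coe_sphere (n := m₂) p.2).hasMFDerivAt.comp p
    (hasMFDerivAt_snd (I := 𝓡 m₁) (I' := 𝓡 m₂) p)
  have h := (mdifferentiableAt_prodEmbedding p).hasMFDerivAt
  have hfst := (WithLp.fstL 2 ℝ (Euc (m₁ + 1)) (Euc (m₂ + 1))).hasFDerivAt.hasMFDerivAt.comp p h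
  have hsnd := (WithLp.sndL 2 ℝ (Euc (m₁ + 1)) (Euc (m₂ + 1))).hasFDerivAt.hasMFDerivAt.comp p h
  refine WithLp.ofLp_injective 2 (Prod.ext ?_ ?_)
  · exact congrArg (fun L => L w) (hasMFDerivAt_unique hfst h1)
  · exact congrArg (fun L => L w) (hasMFDerivAt_unique hsnd h2)

theorem mem_tangentSubspace_prodEmbedding {p : Sph m₁ 1 × Sph m₂ 1} {u : EucSum m₁ m₂} :
    u ∈ tangentSubspace ((𝓡 m₁).prod (𝓡 m₂)) (prodEmbedding m₁ m₂) p ↔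
      ⟪(p.1 : Euc (m₁ + 1)), u.fst⟫ = 0 ∧ ⟪(p.2 : Euc (m₂ + 1)), u.snd⟫ = 0 := by
  rw [← mem_tangentSubspace_sphere (n := m₁), ← mem_tangentSubspace_sphere (n := m₂)]
  constructor
  · rintro ⟨w, rfl⟩
    have h := mvfderiv_prodEmbedding p w
    exact ⟨⟨w.1, (congrArg WithLp.fst h).symm⟩, ⟨w.2, (congrArg WithLp.snd h).symm⟩⟩
  · rintro ⟨⟨w₁, h₁⟩, ⟨w₂, h₂⟩⟩
    refine ⟨((w₁, w₂) : TangentSpace (𝓡 m₁) p.1 × TangentSpace (𝓡 m₂) p.2), ?_⟩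
    refine (mvfderiv_prodEmbedding p _).trans ?_
    change WithLp.toLp 2 (mvfderiv _ _ p.1 w₁, mvfderiv _ _ p.2 w₂) = u
    exact congrArg₂ (fun a b => WithLp.toLp 2 (a, b)) h₁ h₂

theorem tangentProj_prodEmbedding (p : Sph m₁ 1 × Sph m₂ 1) (u : EucSum m₁ m₂) :
    tangentProj ((𝓡 m₁).prod (𝓡 m₂)) (prodEmbedding m₁ m₂) p u =
      WithLp.toLp 2 (u.fst - ⟪(p.1 : Euc (m₁ + 1)), u.fst⟫ • (p.1 : Euc (m₁ + 1)),
        u.snd - ⟪(p.2 : Euc (m₂ + 1)), u.snd⟫ • (p.2 : Euc (m₂ + 1))) := by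
  refine Submodule.eq_starProjection_of_mem_of_inner_eq_zero ?_ fun w hw => ?_
  · rw [mem_tangentSubspace_prodEmbedding]
    constructor <;> simp [inner_sub_right, inner_smul_right]
  · rw [mem_tangentSubspace_prodEmbedding] at hw
    simp [WithLp.prod_inner_apply, inner_smul_left, hw.1, hw.2]

theorem extend_prodEmbedding (u : EucSum m₁ m₂) (p : Sph m₁ 1 × Sph m₂ 1) :
    extend ((𝓡 m₁).prod (𝓡 m₂)) (prodEmbedding m₁ m₂) u p =
      WithLp.toLp 2 (u.fst - ⟪(p.1 : Euc (m₁ + 1)), u.fst⟫ • (p.1 : Euc (m₁ + 1)),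
        u.snd - ⟪(p.2 : Euc (m₂ + 1)), u.snd⟫ • (p.2 : Euc (m₂ + 1))) :=
  tangentProj_prodEmbedding p u

/-- In the union of orthonormal bases of the two summands, each vector contributes to one component
only. -/
theorem traceAt_prodEmbedding {W₁ W₂ : Type*} [AddCommGroup W₁] [Module ℝ W₁] [AddCommGroup W₂]
    [Module ℝ W₂] (p : Sph m₁ 1 × Sph m₂ 1)
    (B₁ : Euc (m₁ + 1) →ₗ[ℝ] Euc (m₁ + 1) →ₗ[ℝ] W₁)
    (B₂ : Euc (m₂ + 1) →ₗ[ℝ] Euc (m₂ + 1) →ₗ[ℝ] W₂) :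
    traceAt ((𝓡 m₁).prod (𝓡 m₂)) (prodEmbedding m₁ m₂) p
      (fun u v => (B₁ u.fst v.fst, B₂ u.snd v.snd)) =
      (traceAt (𝓡 m₁) ((↑) : Sph m₁ 1 → Euc (m₁ + 1)) p.1 (fun u v => B₁ u v),
        traceAt (𝓡 m₂) ((↑) : Sph m₂ 1 → Euc (m₂ + 1)) p.2 (fun u v => B₂ u v)) := by
  let B : EucSum m₁ m₂ →ₗ[ℝ] EucSum m₁ m₂ →ₗ[ℝ] W₁ × W₂ :=
    LinearMap.mk₂ ℝ (fun u v => (B₁ u.fst v.fst, B₂ u.snd v.snd))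
      (fun _ _ _ => by simp) (fun _ _ _ => by simp) (fun _ _ _ => by simp) (fun _ _ _ => by simp)
  have h := traceAt_eq_sum_tangentProj ((𝓡 m₁).prod (𝓡 m₂)) (prodEmbedding m₁ m₂) p
    ((stdOrthonormalBasis ℝ (Euc (m₁ + 1))).prod (stdOrthonormalBasis ℝ (Euc (m₂ + 1)))) B
  refine h.trans ?_
  rw [traceAt_eq_sum_tangentProj _ _ _ (stdOrthonormalBasis ℝ (Euc (m₁ + 1))),
    traceAt_eq_sum_tangentProj _ _ _ (stdOrthonormalBasis ℝ (Euc (m₂ + 1))), Fintype.sum_sum_type]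
  simp only [tangentProj_prodEmbedding, tangentProj_sphere, OrthonormalBasis.prod_apply]
  simp [B, Prod.ext_iff, Prod.fst_sum, Prod.snd_sum]

theorem dirDeriv_prodEmbedding {W₁ W₂ : Type*} [NormedAddCommGroup W₁] [NormedSpace ℝ W₁]
    [NormedAddCommGroup W₂] [NormedSpace ℝ W₂] {p : Sph m₁ 1 × Sph m₂ 1}
    {f : Sph m₁ 1 × Sph m₂ 1 → WithLp 2 (W₁ × W₂)}
    {g₁ : Euc (m₁ + 1) → W₁} {g₂ : Euc (m₂ + 1) → W₂} {g₁' : Euc (m₁ + 1) →L[ℝ] W₁}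
    {g₂' : Euc (m₂ + 1) →L[ℝ] W₂} (h₁ : HasFDerivAt g₁ g₁' (p.1 : Euc (m₁ + 1)))
    (h₂ : HasFDerivAt g₂ g₂' (p.2 : Euc (m₂ + 1)))
    (hf : ∀ q, f q = WithLp.toLp 2 (g₁ q.1, g₂ q.2)) {u : EucSum m₁ m₂}
    (hu : u ∈ tangentSubspace ((𝓡 m₁).prod (𝓡 m₂)) (prodEmbedding m₁ m₂) p) :
    dirDeriv ((𝓡 m₁).prod (𝓡 m₂)) (prodEmbedding m₁ m₂) f p u =
      WithLp.toLp 2 (g₁' u.fst, g₂' u.snd) := by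
  have hfst : HasFDerivAt (fun z : EucSum m₁ m₂ => z.fst)
      (WithLp.fstL 2 ℝ (Euc (m₁ + 1)) (Euc (m₂ + 1))) (prodEmbedding m₁ m₂ p) :=
    (WithLp.fstL 2 ℝ (Euc (m₁ + 1)) (Euc (m₂ + 1))).hasFDerivAt
  have hsnd : HasFDerivAt (fun z : EucSum m₁ m₂ => z.snd)
      (WithLp.sndL 2 ℝ (Euc (m₁ + 1)) (Euc (m₂ + 1))) (prodEmbedding m₁ m₂ p) :=
    (WithLp.sndL 2 ℝ (Euc (m₁ + 1)) (Euc (m₂ + 1))).hasFDerivAt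
  have h := (WithLp.prodContinuousLinearEquiv 2 ℝ W₁ W₂).symm.hasFDerivAt.comp
    (prodEmbedding m₁ m₂ p) ((HasFDerivAt.comp (prodEmbedding m₁ m₂ p) h₁ hfst).prodMk
      (HasFDerivAt.comp (prodEmbedding m₁ m₂ p) h₂ hsnd))
  exact dirDeriv_eq_of_hasFDerivAt (mdifferentiableAt_prodEmbedding p) h hf hu

/-- Projected constant vectors are parallel to first order at `p`, so the correction terms in both
second derivatives drop out. -/
theorem leviCivita_extend_prodEmbedding {p : Sph m₁ 1 × Sph m₂ 1} {u v : EucSum m₁ m₂}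
    (hu : u ∈ tangentSubspace ((𝓡 m₁).prod (𝓡 m₂)) (prodEmbedding m₁ m₂) p)
    (hv : v ∈ tangentSubspace ((𝓡 m₁).prod (𝓡 m₂)) (prodEmbedding m₁ m₂) p) :
    leviCivita ((𝓡 m₁).prod (𝓡 m₂)) (prodEmbedding m₁ m₂)
      (extend ((𝓡 m₁).prod (𝓡 m₂)) (prodEmbedding m₁ m₂) v) p u = 0 := by
  rw [leviCivita, dirDeriv_prodEmbedding (hasFDerivAt_sub_inner_smul v.fst _)
    (hasFDerivAt_sub_inner_smul v.snd _) (extend_prodEmbedding v) hu,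
    tangentProj_prodEmbedding]
  rw [mem_tangentSubspace_prodEmbedding] at hv
  simp [hv.1, hv.2, inner_smul_right]

end ProductOfSpheres

/-! ### Tension and bitension of the product map. -/

section ProductOfSpheres

attribute [local instance] fact_finrank_euc

variable {m₁ m₂ n₁ n₂ k₁ k₂ : ℕ} {r₁ r₂ : ℝ}
  {F₁ : Euc (m₁ + 1) → Euc (n₁ + 1)} {F₂ : Euc (m₂ + 1) → Euc (n₂ + 1)}
  {φ : Sph m₁ 1 × Sph m₂ 1 → SphSum n₁ n₂}

open IsHomogeneousHarmonic

theorem tangentProj_diagonal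
    (hr₁ : ∀ x : Sph m₁ 1, ‖F₁ x‖ = r₁) (hr₂ : ∀ x : Sph m₂ 1, ‖F₂ x‖ = r₂)
    (hφ : ∀ p, (φ p : EucSum n₁ n₂) = WithLp.toLp 2 (F₁ p.1, F₂ p.2))
    (p : Sph m₁ 1 × Sph m₂ 1) (c d : ℝ) :
    tangentProj (𝓡 (n₁ + n₂ + 1)) (Subtype.val : SphSum n₁ n₂ → EucSum n₁ n₂) (φ p)
      (WithLp.toLp 2 (c • F₁ p.1, d • F₂ p.2)) =
      WithLp.toLp 2 ((c - (c * r₁ ^ 2 + d * r₂ ^ 2)) • F₁ p.1,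
        (d - (c * r₁ ^ 2 + d * r₂ ^ 2)) • F₂ p.2) := by
  rw [tangentProj_sphere, hφ]
  have h : ⟪(WithLp.toLp 2 (F₁ p.1, F₂ p.2) : EucSum n₁ n₂),
      WithLp.toLp 2 (c • F₁ p.1, d • F₂ p.2)⟫ = c * r₁ ^ 2 + d * r₂ ^ 2 := by
    simp [WithLp.prod_inner_apply, inner_smul_right, hr₁, hr₂]
  rw [h]
  refine WithLp.ofLp_injective 2 (Prod.ext ?_ ?_)
  · simp [sub_smul]
  · simp [sub_smul]

/-- Orthogonality to (F₁, F₂) holds in each factor separately, hence for arbitrary weights `a`, `b`;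
this makes ∇τ explicit. -/
theorem tangentProj_diagonal_fderiv (hF₁ : IsHomogeneousHarmonic k₁ F₁)
    (hF₂ : IsHomogeneousHarmonic k₂ F₂)
    (hr₁ : ∀ x : Sph m₁ 1, ‖F₁ x‖ = r₁) (hr₂ : ∀ x : Sph m₂ 1, ‖F₂ x‖ = r₂)
    (hφ : ∀ p, (φ p : EucSum n₁ n₂) = WithLp.toLp 2 (F₁ p.1, F₂ p.2))
    (p : Sph m₁ 1 × Sph m₂ 1) (a b : ℝ) {u : EucSum m₁ m₂}
    (hu : u ∈ tangentSubspace ((𝓡 m₁).prod (𝓡 m₂)) (prodEmbedding m₁ m₂) p) :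
    tangentProj (𝓡 (n₁ + n₂ + 1)) (Subtype.val : SphSum n₁ n₂ → EucSum n₁ n₂) (φ p)
      (WithLp.toLp 2 (a • fderiv ℝ F₁ p.1 u.fst, b • fderiv ℝ F₂ p.2 u.snd)) =
      WithLp.toLp 2 (a • fderiv ℝ F₁ p.1 u.fst, b • fderiv ℝ F₂ p.2 u.snd) := by
  rw [mem_tangentSubspace_prodEmbedding] at hu
  refine tangentProj_of_mem (mem_tangentSubspace_sphere.2 ?_)
  rw [hφ]
  simp [WithLp.prod_inner_apply, inner_smul_right, inner_fderiv_eq_zero m₁ hF₁ hr₁ p.1 hu.1,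
    inner_fderiv_eq_zero m₂ hF₂ hr₂ p.2 hu.2]

theorem dirDeriv_diagonal (hF₁ : IsHomogeneousHarmonic k₁ F₁)
    (hF₂ : IsHomogeneousHarmonic k₂ F₂) {a b : ℝ}
    {f : Sph m₁ 1 × Sph m₂ 1 → EucSum n₁ n₂}
    (hf : ∀ q, f q = WithLp.toLp 2 (a • F₁ q.1, b • F₂ q.2))
    {p : Sph m₁ 1 × Sph m₂ 1} {u : EucSum m₁ m₂}
    (hu : u ∈ tangentSubspace ((𝓡 m₁).prod (𝓡 m₂)) (prodEmbedding m₁ m₂) p) :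
    dirDeriv ((𝓡 m₁).prod (𝓡 m₂)) (prodEmbedding m₁ m₂) f p u =
      WithLp.toLp 2 (a • fderiv ℝ F₁ p.1 u.fst, b • fderiv ℝ F₂ p.2 u.snd) :=
  dirDeriv_prodEmbedding ((hF₁.hasFDerivAt _).const_smul a) ((hF₂.hasFDerivAt _).const_smul b)
    hf hu

theorem differential_diagonal (hF₁ : IsHomogeneousHarmonic k₁ F₁)
    (hF₂ : IsHomogeneousHarmonic k₂ F₂)
    (hφ : ∀ p, (φ p : EucSum n₁ n₂) = WithLp.toLp 2 (F₁ p.1, F₂ p.2))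
    {p : Sph m₁ 1 × Sph m₂ 1} {u : EucSum m₁ m₂}
    (hu : u ∈ tangentSubspace ((𝓡 m₁).prod (𝓡 m₂)) (prodEmbedding m₁ m₂) p) :
    differential ((𝓡 m₁).prod (𝓡 m₂)) (prodEmbedding m₁ m₂)
      (Subtype.val : SphSum n₁ n₂ → EucSum n₁ n₂) φ p u =
      WithLp.toLp 2 ((1 : ℝ) • fderiv ℝ F₁ p.1 u.fst, (1 : ℝ) • fderiv ℝ F₂ p.2 u.snd) :=
  dirDeriv_diagonal hF₁ hF₂ (fun q => by simp [hφ]) hu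

/-- The trace of the covariant derivative of a `φ⁻¹TN`-valued one-form `D` that agrees with the
differential of `(a F₁, b F₂)` on tangent vectors. -/
theorem traceAt_pullbackConnection (hF₁ : IsHomogeneousHarmonic k₁ F₁)
    (hF₂ : IsHomogeneousHarmonic k₂ F₂)
    {a b : ℝ} {D : Sph m₁ 1 × Sph m₂ 1 → EucSum m₁ m₂ → EucSum n₁ n₂}
    (hD : ∀ q, ∀ u ∈ tangentSubspace ((𝓡 m₁).prod (𝓡 m₂)) (prodEmbedding m₁ m₂) q,
      D q u = WithLp.toLp 2 (a • fderiv ℝ F₁ q.1 u.fst, b • fderiv ℝ F₂ q.2 u.snd))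
    (p : Sph m₁ 1 × Sph m₂ 1) :
    traceAt ((𝓡 m₁).prod (𝓡 m₂)) (prodEmbedding m₁ m₂) p (fun u v =>
      pullbackConnection ((𝓡 m₁).prod (𝓡 m₂)) (prodEmbedding m₁ m₂)
        (𝓡 (n₁ + n₂ + 1)) (Subtype.val : SphSum n₁ n₂ → EucSum n₁ n₂) φ
        (fun q => D q (extend ((𝓡 m₁).prod (𝓡 m₂)) (prodEmbedding m₁ m₂) v q)) p u
      - D p (leviCivita ((𝓡 m₁).prod (𝓡 m₂)) (prodEmbedding m₁ m₂)
          (extend ((𝓡 m₁).prod (𝓡 m₂)) (prodEmbedding m₁ m₂) v) p u)) =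
      tangentProj (𝓡 (n₁ + n₂ + 1)) (Subtype.val : SphSum n₁ n₂ → EucSum n₁ n₂) (φ p)
        (WithLp.toLp 2 ((-(a * (k₁ * (k₁ + m₁ - 1)))) • F₁ p.1,
          (-(b * (k₂ * (k₂ + m₂ - 1)))) • F₂ p.2)) := by
  -- The projection at the fixed point `φ p` is linear, so it can be taken after the trace.
  let L : Euc (n₁ + 1) × Euc (n₂ + 1) →ₗ[ℝ] EucSum n₁ n₂ :=
    (tangentSubspace (𝓡 (n₁ + n₂ + 1)) (Subtype.val : SphSum n₁ n₂ → EucSum n₁ n₂)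
      (φ p)).starProjection.toLinearMap ∘ₗ (WithLp.linearEquiv 2 ℝ _).symm.toLinearMap
  have hL := traceAt_map (I := (𝓡 m₁).prod (𝓡 m₂)) (ι := prodEmbedding m₁ m₂) (x := p) L
    (fun u v => ((a • sphereHessian F₁ p.1) u.fst v.fst, (b • sphereHessian F₂ p.2) u.snd v.snd))
  rw [traceAt_prodEmbedding] at hL
  have h₁ := traceAt_map (I := 𝓡 m₁) (ι := ((↑) : Sph m₁ 1 → Euc (m₁ + 1))) (x := p.1)
    (a • LinearMap.id) (fun u v => sphereHessian F₁ p.1 u v)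
  have h₂ := traceAt_map (I := 𝓡 m₂) (ι := ((↑) : Sph m₂ 1 → Euc (m₂ + 1))) (x := p.2)
    (b • LinearMap.id) (fun u v => sphereHessian F₂ p.2 u v)
  rw [hF₁.traceAt_sphereHessian] at h₁
  rw [hF₂.traceAt_sphereHessian] at h₂
  simp only [LinearMap.smul_apply, LinearMap.id_apply] at h₁ h₂ hL
  rw [h₁, h₂] at hL
  refine (traceAt_congr fun u hu => ?_).trans (hL.trans ?_)
  · have hu' := mem_tangentSubspace_prodEmbedding.1 hu
    obtain ⟨G₁, hG₁, hG₁'⟩ := hF₁.hasFDerivAt_fderiv_sub_inner_smul u.fst p.1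
    obtain ⟨G₂, hG₂, hG₂'⟩ := hF₂.hasFDerivAt_fderiv_sub_inner_smul u.snd p.2
    rw [leviCivita_extend_prodEmbedding hu hu, hD p 0 (zero_mem _), pullbackConnection,
      dirDeriv_prodEmbedding (hG₁.const_smul a) (hG₂.const_smul b)
        (fun q => by rw [hD q _ (extend_mem _ _ _ _), extend_prodEmbedding]; rfl) hu]
    simp [hG₁' hu'.1, hG₂' hu'.2, L, tangentProj]
  · simp only [L, tangentProj, LinearMap.comp_apply]
    simp [mul_smul]

theorem prodTension_eq (hF₁ : IsHomogeneousHarmonic k₁ F₁)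
    (hF₂ : IsHomogeneousHarmonic k₂ F₂)
    (hr₁ : ∀ x : Sph m₁ 1, ‖F₁ x‖ = r₁) (hr₂ : ∀ x : Sph m₂ 1, ‖F₂ x‖ = r₂)
    (hr : r₁ ^ 2 + r₂ ^ 2 = 1)
    (hφ : ∀ p, (φ p : EucSum n₁ n₂) = WithLp.toLp 2 (F₁ p.1, F₂ p.2))
    (p : Sph m₁ 1 × Sph m₂ 1) :
    prodTension φ p = WithLp.toLp 2
      ((-(r₂ ^ 2 * (k₁ * (k₁ + m₁ - 1) - k₂ * (k₂ + m₂ - 1)))) • F₁ p.1,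
        (r₁ ^ 2 * (k₁ * (k₁ + m₁ - 1) - k₂ * (k₂ + m₂ - 1))) • F₂ p.2) := by
  have h := traceAt_pullbackConnection (φ := φ) hF₁ hF₂ (a := 1) (b := 1)
    (fun q u hu => differential_diagonal hF₁ hF₂ hφ hu) p
  rw [tangentProj_diagonal hr₁ hr₂ hφ] at h
  refine h.trans ?_
  obtain hr' : r₂ ^ 2 = 1 - r₁ ^ 2 := by linarith
  congr 4 <;> rw [hr'] <;> ring

theorem traceAt_inner_differential (hF₁ : IsHomogeneousHarmonic k₁ F₁)
    (hF₂ : IsHomogeneousHarmonic k₂ F₂)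
    (hr₁ : ∀ x : Sph m₁ 1, ‖F₁ x‖ = r₁) (hr₂ : ∀ x : Sph m₂ 1, ‖F₂ x‖ = r₂)
    (hφ : ∀ p, (φ p : EucSum n₁ n₂) = WithLp.toLp 2 (F₁ p.1, F₂ p.2))
    (p : Sph m₁ 1 × Sph m₂ 1) :
    traceAt ((𝓡 m₁).prod (𝓡 m₂)) (prodEmbedding m₁ m₂) p (fun u v =>
      ⟪differential ((𝓡 m₁).prod (𝓡 m₂)) (prodEmbedding m₁ m₂)
        (Subtype.val : SphSum n₁ n₂ → EucSum n₁ n₂) φ p u,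
      differential ((𝓡 m₁).prod (𝓡 m₂)) (prodEmbedding m₁ m₂)
        (Subtype.val : SphSum n₁ n₂ → EucSum n₁ n₂) φ p v⟫) =
      k₁ * (k₁ + m₁ - 1) * r₁ ^ 2 + k₂ * (k₂ + m₂ - 1) * r₂ ^ 2 := by
  rw [← hF₁.traceAt_inner_fderiv (m := m₁) hr₁ p.1, ← hF₂.traceAt_inner_fderiv (m := m₂) hr₂ p.2]
  let B₁ := (innerₗ (Euc (n₁ + 1))).compl₁₂ (fderiv ℝ F₁ p.1).toLinearMap
    (fderiv ℝ F₁ p.1).toLinearMap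
  let B₂ := (innerₗ (Euc (n₂ + 1))).compl₁₂ (fderiv ℝ F₂ p.2).toLinearMap
    (fderiv ℝ F₂ p.2).toLinearMap
  have h := traceAt_map (I := (𝓡 m₁).prod (𝓡 m₂)) (ι := prodEmbedding m₁ m₂) (x := p)
    (LinearMap.fst ℝ ℝ ℝ + LinearMap.snd ℝ ℝ ℝ) (fun u v => (B₁ u.fst v.fst, B₂ u.snd v.snd))
  rw [traceAt_prodEmbedding] at h
  refine (traceAt_congr fun u hu => ?_).trans h
  rw [differential_diagonal hF₁ hF₂ hφ hu]
  simp [B₁, B₂, WithLp.prod_norm_sq_eq_of_L2]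

/-- Curvature 1 gives R(w, t)w = ⟪t, w⟫ w − |w|² t, and t ⟂ w = dφ(u) factor by factor. The
condition `hab` says that `t` is tangent to the target sphere. -/
theorem traceAt_curvature_differential (hF₁ : IsHomogeneousHarmonic k₁ F₁)
    (hF₂ : IsHomogeneousHarmonic k₂ F₂)
    (hr₁ : ∀ x : Sph m₁ 1, ‖F₁ x‖ = r₁) (hr₂ : ∀ x : Sph m₂ 1, ‖F₂ x‖ = r₂)
    (hφ : ∀ p, (φ p : EucSum n₁ n₂) = WithLp.toLp 2 (F₁ p.1, F₂ p.2))
    (p : Sph m₁ 1 × Sph m₂ 1) {a b : ℝ} (hab : a * r₁ ^ 2 + b * r₂ ^ 2 = 0)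
    {t : EucSum n₁ n₂} (ht : t = WithLp.toLp 2 (a • F₁ p.1, b • F₂ p.2)) :
    traceAt ((𝓡 m₁).prod (𝓡 m₂)) (prodEmbedding m₁ m₂) p (fun u v =>
      curvature (𝓡 (n₁ + n₂ + 1)) (Subtype.val : SphSum n₁ n₂ → EucSum n₁ n₂) (φ p)
        (differential ((𝓡 m₁).prod (𝓡 m₂)) (prodEmbedding m₁ m₂)
          (Subtype.val : SphSum n₁ n₂ → EucSum n₁ n₂) φ p u) t
        (differential ((𝓡 m₁).prod (𝓡 m₂)) (prodEmbedding m₁ m₂)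
          (Subtype.val : SphSum n₁ n₂ → EucSum n₁ n₂) φ p v)) =
      -((k₁ * (k₁ + m₁ - 1) * r₁ ^ 2 + k₂ * (k₂ + m₂ - 1) * r₂ ^ 2 : ℝ) • t) := by
  have hL := traceAt_map (I := (𝓡 m₁).prod (𝓡 m₂)) (ι := prodEmbedding m₁ m₂) (x := p)
    (-LinearMap.toSpanSingleton ℝ _ t) (fun u v =>
    ⟪differential ((𝓡 m₁).prod (𝓡 m₂)) (prodEmbedding m₁ m₂)
      (Subtype.val : SphSum n₁ n₂ → EucSum n₁ n₂) φ p u,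
    differential ((𝓡 m₁).prod (𝓡 m₂)) (prodEmbedding m₁ m₂)
      (Subtype.val : SphSum n₁ n₂ → EucSum n₁ n₂) φ p v⟫)
  rw [traceAt_inner_differential hF₁ hF₂ hr₁ hr₂ hφ] at hL
  refine (traceAt_congr fun u hu => ?_).trans hL
  have hu' := mem_tangentSubspace_prodEmbedding.1 hu
  have h₁ := inner_fderiv_eq_zero m₁ hF₁ hr₁ p.1 hu'.1
  have h₂ := inner_fderiv_eq_zero m₂ hF₂ hr₂ p.2 hu'.2
  have hd := differential_diagonal hF₁ hF₂ hφ hu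
  generalize differential ((𝓡 m₁).prod (𝓡 m₂)) (prodEmbedding m₁ m₂)
    (Subtype.val : SphSum n₁ n₂ → EucSum n₁ n₂) φ p u = w at hd ⊢
  have hφw : ⟪(φ p : EucSum n₁ n₂), w⟫ = 0 := by
    rw [hd, hφ]
    simp [WithLp.prod_inner_apply, h₁, h₂]
  have hφt : ⟪(φ p : EucSum n₁ n₂), t⟫ = 0 := by
    rw [ht, hφ]
    simpa [WithLp.prod_inner_apply, inner_smul_right, hr₁, hr₂] using hab
  have htw : ⟪t, w⟫ = 0 := by
    rw [hd, ht]
    simp [WithLp.prod_inner_apply, inner_smul_left, h₁, h₂]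
  rw [curvature_sphere _ hφw hφt hφw, htw, zero_smul, zero_sub]
  rfl

theorem prodBitension_eq (hF₁ : IsHomogeneousHarmonic k₁ F₁)
    (hF₂ : IsHomogeneousHarmonic k₂ F₂)
    (hr₁ : ∀ x : Sph m₁ 1, ‖F₁ x‖ = r₁) (hr₂ : ∀ x : Sph m₂ 1, ‖F₂ x‖ = r₂)
    (hr : r₁ ^ 2 + r₂ ^ 2 = 1)
    (hφ : ∀ p, (φ p : EucSum n₁ n₂) = WithLp.toLp 2 (F₁ p.1, F₂ p.2))
    (p : Sph m₁ 1 × Sph m₂ 1) :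
    prodBitension φ p =
      ((2 * r₁ ^ 2 - 1) * (k₁ * (k₁ + m₁ - 1) - k₂ * (k₂ + m₂ - 1) : ℝ)) • prodTension φ p := by
  set l₁ : ℝ := k₁ * (k₁ + m₁ - 1) with hl₁
  set l₂ : ℝ := k₂ * (k₂ + m₂ - 1) with hl₂
  have hτ := prodTension_eq hF₁ hF₂ hr₁ hr₂ hr hφ
  -- The same trace formula as for τ, now with D = ∇τ and the constant coefficients of τ as weights.
  have h := traceAt_pullbackConnection (φ := φ) hF₁ hF₂
    (D := pullbackConnection ((𝓡 m₁).prod (𝓡 m₂)) (prodEmbedding m₁ m₂)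
        (𝓡 (n₁ + n₂ + 1)) (Subtype.val : SphSum n₁ n₂ → EucSum n₁ n₂) φ (prodTension φ))
    (fun q u hu => by
      rw [pullbackConnection, dirDeriv_diagonal hF₁ hF₂ hτ hu]
      exact tangentProj_diagonal_fderiv hF₁ hF₂ hr₁ hr₂ hφ q _ _ hu) p
  rw [tangentProj_diagonal hr₁ hr₂ hφ] at h
  have hcurv := traceAt_curvature_differential hF₁ hF₂ hr₁ hr₂ hφ p (by ring) (hτ p)
  have hb : prodBitension φ p = - -(traceAt ((𝓡 m₁).prod (𝓡 m₂)) (prodEmbedding m₁ m₂) p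
      (secondCovariantDerivative ((𝓡 m₁).prod (𝓡 m₂)) (prodEmbedding m₁ m₂)
        (𝓡 (n₁ + n₂ + 1)) (Subtype.val : SphSum n₁ n₂ → EucSum n₁ n₂) φ (prodTension φ) p)) -
      -((l₁ * r₁ ^ 2 + l₂ * r₂ ^ 2) • prodTension φ p) := hcurv ▸ rfl
  rw [hb, neg_neg]
  refine (congrArg (· - -((l₁ * r₁ ^ 2 + l₂ * r₂ ^ 2) • prodTension φ p)) h).trans ?_
  have hr' : r₂ ^ 2 = 1 - r₁ ^ 2 := by linarith
  simp only [hτ, ← hl₁, ← hl₂, hr']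
  refine WithLp.ofLp_injective 2 (Prod.ext ?_ ?_)
  · simp
    module
  · simp
    module

theorem contMDiff_diagonal (hF₁ : IsHomogeneousHarmonic k₁ F₁)
    (hF₂ : IsHomogeneousHarmonic k₂ F₂)
    (hφ : ∀ p, (φ p : EucSum n₁ n₂) = WithLp.toLp 2 (F₁ p.1, F₂ p.2)) :
    ContMDiff ((𝓡 m₁).prod (𝓡 m₂)) (𝓡 (n₁ + n₂ + 1)) ∞ φ := by
  have h : ContMDiff ((𝓡 m₁).prod (𝓡 m₂)) 𝓘(ℝ, EucSum n₁ n₂) ∞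
      (fun p => (φ p : EucSum n₁ n₂)) := by
    simp_rw [hφ]
    exact (WithLp.prodContinuousLinearEquiv 2 ℝ (Euc (n₁ + 1))
      (Euc (n₂ + 1))).symm.contDiff.contMDiff.comp
        ((hF₁.contDiff.contMDiff.comp (contMDiff_coe_sphere.comp contMDiff_fst)).prodMk_space
          (hF₂.contDiff.contMDiff.comp (contMDiff_coe_sphere.comp contMDiff_snd)))
  exact h.codRestrict_sphere fun p => (φ p).2

end ProductOfSpheres

end

/-! ### The criterion for proper biharmonicity. -/

theorem mainTheorem2 (m₁ m₂ n₁ n₂ k₁ k₂ : ℕ) (r₁ r₂ : ℝ)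
    (hr₁ : 0 < r₁) (hr₂ : 0 < r₂) (hr : r₁ ^ 2 + r₂ ^ 2 = 1)
    (F₁ : Euc (m₁ + 1) → Euc (n₁ + 1)) (F₂ : Euc (m₂ + 1) → Euc (n₂ + 1))
    (hF₁ : IsHarmonicForm k₁ F₁) (hF₂ : IsHarmonicForm k₂ F₂)
    (φ₁ : Sph m₁ 1 → Sph n₁ r₁) (φ₂ : Sph m₂ 1 → Sph n₂ r₂)
    (hφ₁ : ∀ x : Sph m₁ 1, (φ₁ x : Euc (n₁ + 1)) = F₁ x)
    (hφ₂ : ∀ y : Sph m₂ 1, (φ₂ y : Euc (n₂ + 1)) = F₂ y) :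
    ∃ e₁ e₂ : ℝ,
      (∀ x, sphereEnergyDensity φ₁ x = e₁) ∧
      (∀ y, sphereEnergyDensity φ₂ y = e₂) ∧
      (IsProperBiharmonicProd (productMap hr φ₁ φ₂) ↔
        (r₁ = 1 / Real.sqrt 2 ∧ r₂ = 1 / Real.sqrt 2 ∧ e₁ ≠ e₂)) ∧
      (∀ p, prodBitension (productMap hr φ₁ φ₂) p =
        ((2 * r₁ ^ 2 - 1) * (2 * e₁ / r₁ ^ 2 - 2 * e₂ / r₂ ^ 2)) •
          prodTension (productMap hr φ₁ φ₂) p) := by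
  have hG₁ := hF₁.isHomogeneousHarmonic
  have hG₂ := hF₂.isHomogeneousHarmonic
  have hn₁ : ∀ x : Sph m₁ 1, ‖F₁ x‖ = r₁ := fun x => by
    rw [← hφ₁, mem_sphere_zero_iff_norm.1 (φ₁ x).2]
  have hn₂ : ∀ x : Sph m₂ 1, ‖F₂ x‖ = r₂ := fun x => by
    rw [← hφ₂, mem_sphere_zero_iff_norm.1 (φ₂ x).2]
  have hφ : ∀ p, (productMap hr φ₁ φ₂ p : EucSum n₁ n₂) = WithLp.toLp 2 (F₁ p.1, F₂ p.2) :=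
    fun p => by rw [← hφ₁, ← hφ₂]; rfl
  have hsm := contMDiff_diagonal hG₁ hG₂ hφ
  have hτ := prodTension_eq hG₁ hG₂ hn₁ hn₂ hr hφ
  have hτ₂ := prodBitension_eq hG₁ hG₂ hn₁ hn₂ hr hφ
  -- The witnesses are eᵢ = λᵢ rᵢ² / 2.
  refine ⟨_, _, sphereEnergyDensity_eq hG₁ hφ₁, sphereEnergyDensity_eq hG₂ hφ₂, ?_, fun p => ?_⟩
  · set l₁ : ℝ := k₁ * (k₁ + m₁ - 1)
    set l₂ : ℝ := k₂ * (k₂ + m₂ - 1)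
    have hne : ∀ d : ℕ, Nonempty (Sph d 1) := fun d =>
      (NormedSpace.sphere_nonempty.2 zero_le_one).to_subtype
    obtain ⟨x₀⟩ := hne m₁
    obtain ⟨y₀⟩ := hne m₂
    have hF0 : F₁ x₀ ≠ 0 := fun h => by simpa [h, hr₁.ne] using hn₁ x₀
    -- The first component of τ is −r₂²(l₁ − l₂)F₁, and F₁ has no zero on the sphere.
    have hτ0 : ∀ p, l₁ ≠ l₂ → prodTension (productMap hr φ₁ φ₂) (x₀, p) ≠ 0 := fun p hl h => by
      rw [hτ] at h
      have := congrArg WithLp.fst h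
      simp [hF0, hr₂.ne', sub_eq_zero, hl] at this
    have hsqrt : ∀ r : ℝ, 0 < r → (r = 1 / Real.sqrt 2 ↔ r ^ 2 = 1 / 2) := fun r h => by
      rw [one_div, one_div, ← Real.sqrt_inv, eq_comm, Real.sqrt_eq_iff_eq_sq (by norm_num) h.le,
        eq_comm]
    rw [hsqrt r₁ hr₁, hsqrt r₂ hr₂]
    constructor
    · rintro ⟨hbi, hnh⟩
      have hl : l₁ ≠ l₂ := fun h => hnh ⟨hsm, fun p => (hτ p).trans (by simp [h])⟩
      have h0 := (hτ₂ (x₀, y₀)).symm.trans (hbi.2 (x₀, y₀))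
      -- As τ ≠ 0 and l₁ ≠ l₂, the only factor left to vanish is 2r₁² − 1.
      rw [smul_eq_zero, or_iff_left (hτ0 y₀ hl), mul_eq_zero, or_iff_left (sub_ne_zero.2 hl)] at h0
      have h1 : r₁ ^ 2 = 1 / 2 := by linarith
      have h2 : r₂ ^ 2 = 1 / 2 := by linarith
      refine ⟨h1, h2, fun h => hl ?_⟩
      rw [h1, h2] at h
      linarith
    · rintro ⟨h1, h2, h⟩
      -- For equal radii, the energies differ exactly when the eigenvalues do.
      have hl : l₁ ≠ l₂ := fun hl => h (by rw [h1, h2, hl])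
      refine ⟨⟨hsm, fun p => (hτ₂ p).trans ?_⟩, fun hh => hτ0 y₀ hl (hh.2 _)⟩
      rw [h1]
      norm_num
  · rw [hτ₂]
    congr 2
    field_simp
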